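/- Let $G=(V,E)$ be a graph in which every vertex has finite, nonzero degree. A function $\phi:V\to\mathbb{Z}$ is called harmonic if \[ \phi(x)=\frac{1}{\deg(x)}\sum_{y\sim x}\phi(y)\qquad\text{for every } x\in V, \] and a harmonic labeling of $G$ is a harmonic function $\phi:V\to\mathbb{Z}$ that is both injective and surjective. For $d\ge 1$, regard $\mathbb{Z}^d$ as the graph in which $x$ and $y$ are adjacent if and only if $\sum_{i=1}^d|x_i-y_i|=1$. \textbf{Theorem.} For every integer $d\ge 1$, there is a harmonic labeling of $\mathbb{Z}^d$. -/

import Mathlib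

/-- A function `φ : V → ℤ` on the vertices of a locally finite graph is harmonic if its value
at every vertex is the average (computed in `ℚ`) of its values at the neighbours. -/
def IsHarmonicFun {V : Type*} (G : SimpleGraph V) [G.LocallyFinite] (φ : V → ℤ) : Prop :=
  ∀ x : V, (φ x : ℚ) = (1 / (G.degree x : ℚ)) * ∑ y ∈ G.neighborFinset x, (φ y : ℚ)

/-- A harmonic labeling is a bijective harmonic function from the vertices onto `ℤ`. -/
def IsHarmonicLabeling {V : Type*} (G : SimpleGraph V) [G.LocallyFinite] (φ : V → ℤ) : Prop :=
  IsHarmonicFun G φ ∧ Function.Injective φ ∧ Function.Surjective φ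

/-- The integer lattice `ℤ^d`: two points are adjacent iff their `ℓ¹` distance is `1`. -/
def latticeGraph (d : ℕ) : SimpleGraph (Fin d → ℤ) where
  Adj x y := ∑ i, |x i - y i| = 1
  symm := ⟨fun x y h => by simpa only [abs_sub_comm] using h⟩
  loopless := ⟨fun x h => by simp at h⟩

theorem latticeGraph_neighborSet_finite (d : ℕ) (x : Fin d → ℤ) :
    ((latticeGraph d).neighborSet x).Finite := by
  refine (Set.finite_Icc (fun i => x i - 1) (fun i => x i + 1)).subset ?_
  intro y hy
  have hy' : ∑ i, |x i - y i| = 1 := hy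
  have h : ∀ i, |x i - y i| ≤ 1 := fun i => by
    rw [← hy']
    exact Finset.single_le_sum (f := fun i => |x i - y i|)
      (fun j _ => abs_nonneg _) (Finset.mem_univ i)
  constructor <;> intro i <;> have := abs_le.mp (h i) <;> simp only <;> omega

noncomputable instance latticeGraph_locallyFinite (d : ℕ) : (latticeGraph d).LocallyFinite :=
  fun x => (latticeGraph_neighborSet_finite d x).fintype

/-! For `d = 1` the identity works. For `d = n + 1 ≥ 2`, view the lattice as layers `ℤ^n × {t}`:
harmonicity reads `φ (t+1) + φ (t-1) = A (φ t)`, so arbitrary integer data on layers 0 and 1 extend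
uniquely to an integer harmonic function, by Chebyshev polynomials in `A`. The data are built by
finite commitments, never making two vertices equal for all remaining data. Committing a datum
excludes only finitely many values (`finite_confused`). A missing integer `k` is placed at a far
away vertex (`exists_isolated`): a collision there would mean that `k` was already forced elsewhere.
A generic sequence of commitments then gives a bijection. Both inputs rest on `lineKernel_rigidity`.
Data depending on one coordinate evolve as in the plane, with a kernel whose two outermost
coefficients reveal its centre and time. -/

/-! ### Generic data for a linear extension operator. -/

/-- A finite commitment on the data of a harmonic function: the values of `data` on `support` are
fixed, and any two vertices can still be separated by data agreeing with these values. -/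
structure SeparatingCondition {S V : Type*} (E : (S → ℤ) →ₗ[ℤ] (V → ℤ)) where
  support : Finset S
  data : S → ℤ
  separates : ∀ v w, v ≠ w → ∃ h : S → ℤ, (∀ s ∈ support, h s = data s) ∧ E h v ≠ E h w

namespace SeparatingCondition

variable {S V : Type*} {E : (S → ℤ) →ₗ[ℤ] (V → ℤ)}

instance : Preorder (SeparatingCondition E) where
  le p q := p.support ⊆ q.support ∧ ∀ s ∈ p.support, q.data s = p.data s
  le_refl p := ⟨subset_rfl, fun _ _ => rfl⟩
  le_trans p q r hpq hqr :=
    ⟨hpq.1.trans hqr.1, fun s hs => (hqr.2 s (hpq.1 hs)).trans (hpq.2 s hs)⟩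

/-- Committing one more value extends a condition as soon as vertices remain separated. -/
theorem exists_extension [DecidableEq S] (p : SeparatingCondition E) {s : S} (hs : s ∉ p.support)
    (x : ℤ) (hx : ∀ v w, v ≠ w →
      ∃ h : S → ℤ, (∀ u ∈ p.support, h u = p.data u) ∧ h s = x ∧ E h v ≠ E h w) :
    ∃ q : SeparatingCondition E, p ≤ q ∧ s ∈ q.support ∧ q.data s = x := by
  refine ⟨⟨insert s p.support, Function.update p.data s x, fun v w hvw => ?_⟩,
    ⟨Finset.subset_insert _ _, fun u hu => ?_⟩, Finset.mem_insert_self _ _, by simp⟩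
  · obtain ⟨h, hp, hs', hne⟩ := hx v w hvw
    refine ⟨h, fun u hu => ?_, hne⟩
    rcases eq_or_ne u s with rfl | hus
    · simpa using hs'
    · rw [Function.update_of_ne hus]
      exact hp u (Finset.mem_of_mem_insert_of_ne hu hus)
  · have hus : u ≠ s := fun h => hs (h ▸ hu)
    simp [hus]

/-- If only finitely many vertices can be confused once the data on a finite set are known, then
every datum can be committed. -/
theorem exists_le_mem_support
    (hfin : ∀ T : Finset S, ∃ B : Set V, B.Finite ∧ ∀ v w, v ≠ w →
      (∀ h : S → ℤ, (∀ s ∈ T, h s = 0) → E h v = E h w) → v ∈ B)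
    (p : SeparatingCondition E) (s : S) : ∃ q, p ≤ q ∧ s ∈ q.support := by
  classical
  by_cases hs : s ∈ p.support
  · exact ⟨p, le_rfl, hs⟩
  obtain ⟨B, hB, hBmem⟩ := hfin (insert s p.support)
  -- The values at `s` that would make the pair `z` inseparable.
  let bad : V × V → Set ℤ := fun z => {x | z.1 ≠ z.2 ∧ ∀ h : S → ℤ,
    (∀ u ∈ p.support, h u = p.data u) → h s = x → E h z.1 = E h z.2}
  -- Along changes of the datum at `s`, the difference of the two values is affine. Two zeros would
  -- make it constantly zero, against the separation granted by `p`.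
  have hbad : ∀ z, (bad z).Subsingleton := by
    rintro ⟨v, w⟩ x ⟨hvw, hx⟩ y ⟨-, hy⟩
    by_contra hxy
    obtain ⟨h, hp, hne⟩ := p.separates v w hvw
    have hupd : ∀ c : ℤ, ∀ u ∈ p.support, (h + (c - h s) • Pi.single s 1 : S → ℤ) u = p.data u := by
      intro c u hu
      have hus : u ≠ s := fun h => hs (h ▸ hu)
      simp [hus, hp u hu]
    have h1 := hx _ (hupd x) (by simp)
    have h2 := hy _ (hupd y) (by simp)
    simp only [map_add, map_smul, Pi.add_apply, Pi.smul_apply, smul_eq_mul] at h1 h2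
    have h3 : (x - y) * (E (Pi.single s 1) v - E (Pi.single s 1) w) = 0 := by linarith
    rcases mul_eq_zero.1 h3 with h3 | h3
    · exact hxy (sub_eq_zero.1 h3)
    · rw [sub_eq_zero.1 h3] at h1
      exact hne (by linarith)
  have hfinite : (⋃ z ∈ B ×ˢ B, bad z).Finite :=
    (hB.prod hB).biUnion fun z _ => (hbad z).finite
  obtain ⟨x, hx⟩ := hfinite.exists_notMem
  obtain ⟨q, hpq, hq, -⟩ := p.exists_extension hs x fun v w hvw => by
    by_contra! hcon
    refine hx (Set.mem_biUnion (x := (v, w)) ?_ ⟨hvw, hcon⟩)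
    -- Subtracting two admissible data shows that a bad pair is confused by all data vanishing on
    -- the enlarged support, hence lies in the finite set `B ×ˢ B`.
    have hzero : ∀ h : S → ℤ, (∀ u ∈ insert s p.support, h u = 0) → E h v = E h w := by
      intro h hh
      have hps : ∀ u ∈ p.support, Function.update p.data s x u = p.data u := fun u hu =>
        Function.update_of_ne (fun hus : u = s => hs (hus ▸ hu)) _ _
      have h1 := hcon (Function.update p.data s x) hps (by simp)
      have h2 := hcon (Function.update p.data s x + h)
        (fun u hu => by simp [hps u hu, hh u (Finset.mem_insert_of_mem hu)])
        (by simp [hh s (Finset.mem_insert_self _ _)])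
      simp only [map_add, Pi.add_apply] at h2
      linarith
    exact ⟨hBmem v w hvw hzero, hBmem w v hvw.symm fun h hh => (hzero h hh).symm⟩
  exact ⟨q, hpq, hq⟩

/-- If far away data are confused with nothing but themselves, then every integer can be committed
as a value. -/
theorem exists_le_value [DecidableEq S] (ι : S → V) (hι : ∀ h s, E h (ι s) = h s)
    (hfar : ∀ T : Finset S, ∃ s ∉ T, ∀ v w,
      (∀ h : S → ℤ, h s = 0 → (∀ u ∈ T, h u = 0) → E h v = E h w) →
      E (Pi.single s 1) v ≠ E (Pi.single s 1) w →
      (v = ι s ∧ E (Pi.single s 1) w = 0) ∨ (w = ι s ∧ E (Pi.single s 1) v = 0))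
    (p : SeparatingCondition E) (k : ℤ) :
    ∃ q, p ≤ q ∧ ∃ v, ∀ h : S → ℤ, (∀ u ∈ q.support, h u = q.data u) → E h v = k := by
  by_cases hk : ∃ v, ∀ h : S → ℤ, (∀ u ∈ p.support, h u = p.data u) → E h v = k
  · exact ⟨p, le_rfl, hk⟩
  obtain ⟨s, hs, hfar⟩ := hfar p.support
  obtain ⟨q, hpq, hq, hqs⟩ := p.exists_extension hs k fun v w hvw => by
    by_contra! hcon
    have hupd : ∀ h : S → ℤ, (∀ u ∈ p.support, h u = p.data u) →
        ∀ u ∈ p.support, (h + (k - h s) • Pi.single s 1 : S → ℤ) u = p.data u := by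
      intro h hp u hu
      have hus : u ≠ s := fun h => hs (h ▸ hu)
      simp [hus, hp u hu]
    have hD : ∀ h : S → ℤ, (∀ u ∈ p.support, h u = p.data u) →
        E h v + (k - h s) * E (Pi.single s 1) v = E h w + (k - h s) * E (Pi.single s 1) w := by
      intro h hp
      have := hcon _ (hupd h hp) (by simp)
      simpa only [map_add, map_smul, Pi.add_apply, Pi.smul_apply, smul_eq_mul] using this
    have hzero : ∀ h : S → ℤ, h s = 0 → (∀ u ∈ p.support, h u = 0) → E h v = E h w := by
      intro h h0 hh
      have h1 := hD p.data fun _ _ => rfl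
      have h2 := hD (p.data + h) fun u hu => by simp [hh u hu]
      simp only [map_add, Pi.add_apply, h0] at h2
      linarith
    have hne : E (Pi.single s 1) v ≠ E (Pi.single s 1) w := by
      intro heq
      obtain ⟨h, hp, hne⟩ := p.separates v w hvw
      have := hD h hp
      rw [heq] at this
      exact hne (by linarith)
    -- The vertex other than `ι s` does not feel the datum at `s`, so the collision says that its
    -- value is `k` for all data meeting `p`: `k` was already forced.
    apply hk
    rcases hfar v w hzero hne with ⟨rfl, h0⟩ | ⟨rfl, h0⟩
    · refine ⟨w, fun h hp => ?_⟩
      have := hD h hp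
      rw [h0, hι, hι, Pi.single_eq_same] at this
      linarith
    · refine ⟨v, fun h hp => ?_⟩
      have := hD h hp
      rw [h0, hι, hι, Pi.single_eq_same] at this
      linarith
  exact ⟨q, hpq, ι s, fun h hh => by rw [hι, hh s hq, hqs]⟩

/-- A linear extension operator from initial data, of finite range, that separates vertices
robustly, produces a bijection onto `ℤ` for suitable data. -/
theorem exists_bijective [Countable S] [DecidableEq S] (E : (S → ℤ) →ₗ[ℤ] (V → ℤ)) (ι : S → V)
    (hι : ∀ h s, E h (ι s) = h s)
    (hloc : ∀ v, ∃ F : Finset S, ∀ h : S → ℤ, (∀ s ∈ F, h s = 0) → E h v = 0)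
    (hsep : ∀ v w, (∀ h, E h v = E h w) → v = w)
    (hfin : ∀ T : Finset S, ∃ B : Set V, B.Finite ∧ ∀ v w, v ≠ w →
      (∀ h : S → ℤ, (∀ s ∈ T, h s = 0) → E h v = E h w) → v ∈ B)
    (hfar : ∀ T : Finset S, ∃ s ∉ T, ∀ v w,
      (∀ h : S → ℤ, h s = 0 → (∀ u ∈ T, h u = 0) → E h v = E h w) →
      E (Pi.single s 1) v ≠ E (Pi.single s 1) w →
      (v = ι s ∧ E (Pi.single s 1) w = 0) ∨ (w = ι s ∧ E (Pi.single s 1) v = 0)) :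
    ∃ h, Function.Bijective (E h) := by
  classical
  have := Encodable.ofCountable S
  let p₀ : SeparatingCondition E := ⟨∅, 0, fun v w hvw => by
    by_contra! hcon
    exact hvw (hsep v w fun h => hcon h (by simp))⟩
  let 𝒟 : S ⊕ ℤ → Order.Cofinal (SeparatingCondition E) := Sum.elim
    (fun s => ⟨{q | s ∈ q.support}, fun p => by
      obtain ⟨q, hpq, hq⟩ := exists_le_mem_support hfin p s
      exact ⟨q, hq, hpq⟩⟩)
    (fun k => ⟨{q | ∃ v, ∀ h : S → ℤ, (∀ u ∈ q.support, h u = q.data u) → E h v = k}, fun p => by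
      obtain ⟨q, hpq, hq⟩ := exists_le_value ι hι hfar p k
      exact ⟨q, hq, hpq⟩⟩)
  let c := Order.sequenceOfCofinals p₀ 𝒟
  have hc : Monotone c := Order.sequenceOfCofinals.monotone p₀ 𝒟
  have hmem : ∀ i, c (Encodable.encode i + 1) ∈ 𝒟 i := Order.sequenceOfCofinals.encode_mem p₀ 𝒟
  have hcover : ∀ s, ∃ m, s ∈ (c m).support := fun s => ⟨_, hmem (Sum.inl s)⟩
  choose m hm using hcover
  let f : S → ℤ := fun s => (c (m s)).data s
  have hf : ∀ j, ∀ s ∈ (c j).support, f s = (c j).data s := by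
    intro j s hs
    rcases le_total j (m s) with h | h
    · exact (hc h).2 s hs
    · exact ((hc h).2 s (hm s)).symm
  refine ⟨f, fun v w hvw => ?_, fun k => ?_⟩
  · by_contra hne
    obtain ⟨F, hF⟩ := hloc v
    obtain ⟨F', hF'⟩ := hloc w
    -- By this stage all data that the values at `v` and `w` depend on are committed, so the
    -- separating data of `c j` can be traded for `f`.
    let j := (F ∪ F').sup m
    obtain ⟨h, hh, hne⟩ := (c j).separates v w hne
    have hagree : ∀ s ∈ F ∪ F', (h - f) s = 0 := by
      intro s hs
      have hsj := (hc (Finset.le_sup hs : m s ≤ j)).1 (hm s)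
      simp [hh s hsj, hf j s hsj]
    have h1 := hF (h - f) fun s hs => hagree s (Finset.mem_union_left _ hs)
    have h2 := hF' (h - f) fun s hs => hagree s (Finset.mem_union_right _ hs)
    simp only [map_sub, Pi.sub_apply] at h1 h2
    exact hne (by linarith)
  · obtain ⟨v, hv⟩ := hmem (Sum.inr k)
    exact ⟨v, hv f (hf _)⟩

end SeparatingCondition

/-! ### Transfer operators and the planar kernel. -/

/-- The transfer operator `u ↦ 4 u - (shifts of u)` on functions on `ℤ`. -/
def lineOperator : Module.End ℤ (ℤ → ℤ) where
  toFun u y := 4 * u y - (u (y + 1) + u (y - 1))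
  map_add' u v := by ext y; simp only [Pi.add_apply]; ring
  map_smul' c u := by ext y; simp only [Pi.smul_apply, smul_eq_mul, RingHom.id_apply]; ring

/-- Harmonic functions on `ℤ^{n+1}` satisfy `φ (t+1) + φ (t-1) = A (φ t)` for this operator `A` on
the functions on the layers. -/
def layerOperator (n : ℕ) : Module.End ℤ ((Fin n → ℤ) → ℤ) where
  toFun u x := 2 * (n + 1) * u x - ∑ i, (u (x + Pi.single i 1) + u (x - Pi.single i 1))
  map_add' u v := by
    ext x
    simp only [Pi.add_apply, Finset.sum_add_distrib]
    ring
  map_smul' c u := by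
    ext x
    simp only [Pi.smul_apply, smul_eq_mul, RingHom.id_apply, ← mul_add, ← Finset.mul_sum]
    ring

open Polynomial Polynomial.Chebyshev

/-- The contribution of the point mass at `y` in layer `1` to layer `t`, in the planar case. -/
noncomputable def lineKernel (t y : ℤ) : ℤ → ℤ :=
  aeval lineOperator (S ℤ (t - 1)) (Pi.single y 1)

theorem lineKernel_zero (y : ℤ) : lineKernel 0 y = 0 := by simp [lineKernel]

theorem lineKernel_one (y : ℤ) : lineKernel 1 y = Pi.single y 1 := by simp [lineKernel]

theorem lineKernel_neg (t y : ℤ) : lineKernel (-t) y = -lineKernel t y := by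
  simp [lineKernel, S_neg_sub_one]

theorem lineKernel_add_two (t y z : ℤ) : lineKernel (t + 2) y z = 4 * lineKernel (t + 1) y z -
    (lineKernel (t + 1) y (z + 1) + lineKernel (t + 1) y (z - 1)) - lineKernel t y z := by
  have h : S ℤ (t + 2 - 1) = X * S ℤ (t + 1 - 1) - S ℤ (t - 1) := by
    rw [show t + 2 - 1 = (t - 1) + 2 by ring, S_add_two]
    congr 3
    ring
  unfold lineKernel
  rw [h]
  simp [lineOperator]

/-- The top terms of `S_{m-1}(4 - shifts)`: the extreme coefficient flips sign at each step, and the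
next one collects a factor 4 from each of the `m - 1` steps. -/
theorem lineKernel_natCast (m : ℕ) (y z : ℤ) :
    (m ≤ (z - y).natAbs → lineKernel m y z = 0) ∧
    ((z - y).natAbs + 1 = m → lineKernel m y z = -(-1) ^ m) ∧
    ((z - y).natAbs + 2 = m → lineKernel m y z = (-1) ^ m * (4 * (m - 1))) := by
  induction m using Nat.twoStepInduction generalizing z with
  | zero => exact ⟨fun _ => by simp [lineKernel_zero], fun h => by omega, fun h => by omega⟩
  | one =>
    refine ⟨fun h => ?_, fun h => ?_, fun h => by omega⟩
    · have : z ≠ y := by omega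
      simp [lineKernel_one, this]
    · obtain rfl : z = y := by omega
      simp [lineKernel_one]
  | more m ih ih' =>
    have hrec := lineKernel_add_two m y z
    push_cast at ih' ⊢
    rw [hrec, pow_succ, pow_succ]
    obtain ⟨a, -, -⟩ := ih z
    obtain ⟨b, b', -⟩ := ih' z
    obtain ⟨c, c', c''⟩ := ih' (z + 1)
    obtain ⟨d, d', d''⟩ := ih' (z - 1)
    rw [pow_succ] at b' c' d' c'' d''
    refine ⟨fun h => ?_, fun h => ?_, fun h => ?_⟩
    · rw [a (by omega), b (by omega), c (by omega), d (by omega)]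
      ring
    · rw [a (by omega), b (by omega)]
      rcases le_total 0 (z - y) with hz | hz
      · rw [c (by omega), d' (by omega)]
        ring
      · rw [d (by omega), c' (by omega)]
        ring
    · rw [a (by omega), b' (by omega)]
      rcases lt_trichotomy 0 (z - y) with hz | hz | hz
      · rw [c (by omega), d'' (by omega)]
        ring
      · obtain rfl : m = 0 := by omega
        rw [c (by omega), d (by omega)]
        norm_num
      · rw [d (by omega), c'' (by omega)]
        ring

/-- Outside its light cone the kernel vanishes. -/
theorem lineKernel_eq_zero {t y z : ℤ} (h : t.natAbs ≤ (z - y).natAbs) :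
    lineKernel t y z = 0 := by
  obtain ⟨m, rfl | rfl⟩ := t.eq_nat_or_neg
  · exact (lineKernel_natCast m y z).1 (by omega)
  · rw [lineKernel_neg, Pi.neg_apply, (lineKernel_natCast m y z).1 (by omega), neg_zero]

/-- The two outermost coefficients of the kernel determine its time parameter. -/
theorem exists_lineKernel_boundary {t : ℤ} (ht : t ≠ 0) : ∃ ε : ℤ, (ε = 1 ∨ ε = -1) ∧
    ε * (-1) ^ t.natAbs = - t.sign ∧
    (∀ y z, (z - y).natAbs + 1 = t.natAbs → lineKernel t y z = ε) ∧
    (∀ y z, (z - y).natAbs + 2 = t.natAbs →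
      lineKernel t y z = -ε * (4 * (t.natAbs - 1))) := by
  obtain ⟨m, rfl | rfl⟩ := t.eq_nat_or_neg
  · refine ⟨-(-1) ^ m, ?_, ?_, fun y z h => ?_, fun y z h => ?_⟩
    · rcases neg_one_pow_eq_or ℤ m with h | h <;> simp [h]
    · rw [Int.natAbs_natCast, Int.sign_natCast_of_ne_zero (by omega)]
      rcases neg_one_pow_eq_or ℤ m with h | h <;> simp [h]
    · exact (lineKernel_natCast m y z).2.1 (by omega)
    · rw [(lineKernel_natCast m y z).2.2 (by omega)]
      simp
  · refine ⟨(-1) ^ m, neg_one_pow_eq_or ℤ m, ?_, fun y z h => ?_, fun y z h => ?_⟩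
    · rw [Int.natAbs_neg, Int.natAbs_natCast, Int.sign_neg, Int.sign_natCast_of_ne_zero (by omega)]
      rcases neg_one_pow_eq_or ℤ m with h | h <;> simp [h]
    · rw [lineKernel_neg, Pi.neg_apply, (lineKernel_natCast m y z).2.1 (by omega), neg_neg]
    · rw [lineKernel_neg, Pi.neg_apply, (lineKernel_natCast m y z).2.2 (by omega)]
      simp

/-! ### Rigidity of the planar kernel. -/

/-- A translated kernel vanishing outside `[-R, R]` is supported there. -/
theorem natAbs_add_natAbs_le_of_lineKernel_eq_zero {R t x : ℤ} (ht : t ≠ 0)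
    (h : ∀ y : ℤ, R < y.natAbs → lineKernel t y x = 0) :
    (x.natAbs + t.natAbs : ℤ) ≤ R + 2 := by
  obtain ⟨ε, hε, -, hb, -⟩ := exists_lineKernel_boundary ht
  have key : ∀ y : ℤ, (x - y).natAbs + 1 = t.natAbs → (y.natAbs : ℤ) ≤ R := by
    intro y hy
    by_contra! hR
    have := h y hR
    rw [hb _ _ hy] at this
    omega
  have k1 := key (x + (t.natAbs - 1)) (by omega)
  have k2 := key (x - (t.natAbs - 1)) (by omega)
  omega

/-- Two translated kernels that agree outside `[-R, R]` are equal or nearly supported there. -/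
theorem lineKernel_rigidity {R t t' x x' : ℤ}
    (h : ∀ y : ℤ, R < y.natAbs → lineKernel t y x = lineKernel t' y x') :
    (t = t' ∧ (t = 0 ∨ x = x')) ∨
      ((t ≠ 0 → (x.natAbs + t.natAbs : ℤ) ≤ R + 2) ∧
        (t' ≠ 0 → (x'.natAbs + t'.natAbs : ℤ) ≤ R + 2)) := by
  by_cases ht : t = 0
  · by_cases ht' : t' = 0
    · exact Or.inl ⟨ht.trans ht'.symm, Or.inl ht⟩
    · refine Or.inr ⟨fun h => (h ht).elim, fun _ => ?_⟩
      subst ht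
      exact natAbs_add_natAbs_le_of_lineKernel_eq_zero ht' fun y hy => by
        rw [← h y hy, lineKernel_zero, Pi.zero_apply]
  by_cases ht' : t' = 0
  · refine Or.inr ⟨fun _ => ?_, fun h => (h ht').elim⟩
    subst ht'
    exact natAbs_add_natAbs_le_of_lineKernel_eq_zero ht fun y hy => by
      rw [h y hy, lineKernel_zero, Pi.zero_apply]
  obtain ⟨ε, hε, hs, hb, hc⟩ := exists_lineKernel_boundary ht
  obtain ⟨ε', hε', hs', hb', hc'⟩ := exists_lineKernel_boundary ht'
  have left_only : ∀ y : ℤ, (x - y).natAbs + 1 = t.natAbs → t'.natAbs ≤ (x' - y).natAbs →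
      (y.natAbs : ℤ) ≤ R := by
    intro y hy hy'
    by_contra! hR
    have := h y hR
    rw [hb _ _ hy, lineKernel_eq_zero hy'] at this
    omega
  have right_only : ∀ y : ℤ, (x' - y).natAbs + 1 = t'.natAbs → t.natAbs ≤ (x - y).natAbs →
      (y.natAbs : ℤ) ≤ R := by
    intro y hy hy'
    by_contra! hR
    have := h y hR
    rw [hb' _ _ hy, lineKernel_eq_zero hy'] at this
    omega
  have both : ∀ y : ℤ, (x - y).natAbs + 1 = t.natAbs → (x' - y).natAbs + 1 = t'.natAbs →
      R < y.natAbs → ε = ε' := by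
    intro y hy hy' hR
    rw [← hb _ _ hy, ← hb' _ _ hy', h y hR]
  -- For radius 1 there is no second coefficient, but the formula `4 * (|t| - 1)` correctly gives 0
  -- outside the cone.
  have inner : ∀ y : ℤ,
      ((x - y).natAbs + 2 = t.natAbs ∨ t.natAbs = 1 ∧ t.natAbs ≤ (x - y).natAbs) →
      ((x' - y).natAbs + 2 = t'.natAbs ∨ t'.natAbs = 1 ∧ t'.natAbs ≤ (x' - y).natAbs) →
      R < y.natAbs → ε = ε' → t.natAbs = t'.natAbs := by
    intro y hy hy' hR hεε
    have e : lineKernel t y x = -ε * (4 * (t.natAbs - 1)) := by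
      rcases hy with hy | ⟨h1, hy⟩
      · exact hc _ _ hy
      · rw [lineKernel_eq_zero hy, h1]; simp
    have e' : lineKernel t' y x' = -ε' * (4 * (t'.natAbs - 1)) := by
      rcases hy' with hy | ⟨h1, hy⟩
      · exact hc' _ _ hy
      · rw [lineKernel_eq_zero hy, h1]; simp
    have := h y hR
    rw [e, e', hεε] at this
    rcases hε' with rfl | rfl <;> omega
  have time_eq : t.natAbs = t'.natAbs → ε = ε' → t = t' := by
    intro hn hεε
    rw [hn, hεε, hs', neg_inj] at hs
    rw [← Int.sign_mul_natAbs t, ← Int.sign_mul_natAbs t', hn, hs]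
  have hp : 0 < t.natAbs := Int.natAbs_pos.2 ht
  have hp' : 0 < t'.natAbs := Int.natAbs_pos.2 ht'
  clear hs hs' hb hb' hc hc' h hε hε'
  have right_end : x + t.natAbs ≠ x' + t'.natAbs →
      x + (t.natAbs - 1) ≤ R ∧ x' + (t'.natAbs - 1) ≤ R := by
    intro hne
    rcases lt_or_gt_of_ne hne with hlt | hlt
    · have := right_only (x' + (t'.natAbs - 1)) (by omega) (by omega)
      omega
    · have := left_only (x + (t.natAbs - 1)) (by omega) (by omega)
      omega
  have left_end : x - t.natAbs ≠ x' - t'.natAbs →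
      -R ≤ x - (t.natAbs - 1) ∧ -R ≤ x' - (t'.natAbs - 1) := by
    intro hne
    rcases lt_or_gt_of_ne hne with hlt | hlt
    · have := left_only (x - (t.natAbs - 1)) (by omega) (by omega)
      omega
    · have := right_only (x' - (t'.natAbs - 1)) (by omega) (by omega)
      omega
  clear left_only right_only
  -- The bound is `R + 1` rather than `R` because comparing second coefficients requires the
  -- position one step inside the common end to lie beyond `R`.
  suffices (t = t' ∧ x = x') ∨ (x + (t.natAbs - 1) ≤ R + 1 ∧ x' + (t'.natAbs - 1) ≤ R + 1 ∧
      -(R + 1) ≤ x - (t.natAbs - 1) ∧ -(R + 1) ≤ x' - (t'.natAbs - 1)) by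
    rcases this with ⟨h, h'⟩ | ⟨h1, h2, h3, h4⟩
    · exact Or.inl ⟨h, Or.inr h'⟩
    · exact Or.inr ⟨fun _ => by omega, fun _ => by omega⟩
  by_cases hr : x + t.natAbs = x' + t'.natAbs
  · by_cases hl : x - t.natAbs = x' - t'.natAbs
    · by_cases hR : R < (x + (t.natAbs - 1)).natAbs
      · have := time_eq (by omega) (both _ (by omega) (by omega) hR)
        omega
      by_cases hR' : R < (x - (t.natAbs - 1)).natAbs
      · have := time_eq (by omega) (both _ (by omega) (by omega) hR')
        omega
      omega
    · obtain ⟨h1, h2⟩ := left_end hl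
      by_cases hR : x + (t.natAbs - 1) ≤ R + 1
      · omega
      -- A common right end beyond `R + 1` makes both outer coefficients visible, so the radii
      -- agree, contradicting the distinct left ends.
      · have := inner (x + (t.natAbs - 2)) (by omega) (by omega) (by omega)
          (both (x + (t.natAbs - 1)) (by omega) (by omega) (by omega))
        omega
  · obtain ⟨h1, h2⟩ := right_end hr
    by_cases hl : x - t.natAbs = x' - t'.natAbs
    · by_cases hR : -(R + 1) ≤ x - (t.natAbs - 1)
      · omega
      · have := inner (x - (t.natAbs - 2)) (by omega) (by omega) (by omega)
          (both (x - (t.natAbs - 1)) (by omega) (by omega) (by omega))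
        omega
    · have := left_end hl
      omega


/-! ### Reduction to one coordinate, and finite range. -/

theorem layerOperator_apply {n : ℕ} (u : (Fin n → ℤ) → ℤ) (x : Fin n → ℤ) :
    layerOperator n u x =
      2 * (n + 1) * u x - ∑ i, (u (x + Pi.single i 1) + u (x - Pi.single i 1)) :=
  rfl

/-- Each of the `n - 1` idle directions cancels 2 from the diagonal coefficient `2 * (n + 1)`,
leaving the planar 4. -/
theorem layerOperator_comp_eval {n : ℕ} (i : Fin n) (g : ℤ → ℤ) :
    layerOperator n (fun x => g (x i)) = fun x => lineOperator g (x i) := by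
  ext x
  have hsum : ∑ j, (g ((x + Pi.single j 1 : Fin n → ℤ) i) + g ((x - Pi.single j 1 : Fin n → ℤ) i)) =
      (g (x i + 1) + g (x i - 1)) + (n - 1) * (2 * g (x i)) := by
    rw [← Finset.add_sum_erase _ _ (Finset.mem_univ i)]
    congr 1
    · simp
    · have hn : 1 ≤ n := i.pos
      rw [Finset.sum_congr rfl (g := fun _ => 2 * g (x i)) fun j hj => ?_, Finset.sum_const,
        Finset.card_erase_of_mem (Finset.mem_univ i), Finset.card_univ, Fintype.card_fin]
      · simp [Nat.cast_sub hn]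
      · have hji : i ≠ j := (Finset.ne_of_mem_erase hj).symm
        simp only [Pi.add_apply, Pi.sub_apply, Pi.single_eq_of_ne hji]
        ring_nf
  rw [layerOperator_apply, hsum]
  simp only [lineOperator, LinearMap.coe_mk, AddHom.coe_mk]
  ring

theorem aeval_layerOperator_comp_eval {n : ℕ} (i : Fin n) (P : ℤ[X]) (g : ℤ → ℤ) :
    aeval (layerOperator n) P (fun x => g (x i)) = fun x => aeval lineOperator P g (x i) := by
  induction P using Polynomial.induction_on' generalizing g with
  | add p q hp hq =>
    ext x
    simp [hp, hq]
  | monomial m a =>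
    induction m generalizing g with
    | zero => ext x; simp
    | succ m ih =>
      rw [← monomial_mul_X, map_mul, map_mul, aeval_X, aeval_X, Module.End.mul_apply,
        layerOperator_comp_eval, ih, Module.End.mul_apply]

/-- Polynomials in the layer operator have finite range. -/
theorem exists_range_aeval_layerOperator (n : ℕ) (P : ℤ[X]) :
    ∃ r : ℕ, ∀ (u : (Fin n → ℤ) → ℤ) (x : Fin n → ℤ),
      (∀ z, (∀ i, (z i - x i).natAbs ≤ r) → u z = 0) → aeval (layerOperator n) P u x = 0 := by
  induction P using Polynomial.induction_on' with
  | add p q hp hq =>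
    obtain ⟨r, hr⟩ := hp
    obtain ⟨r', hr'⟩ := hq
    refine ⟨max r r', fun u x hu => ?_⟩
    rw [map_add, LinearMap.add_apply, Pi.add_apply,
      hr u x fun z hz => hu z fun i => (hz i).trans (le_max_left _ _),
      hr' u x fun z hz => hu z fun i => (hz i).trans (le_max_right _ _), add_zero]
  | monomial m a =>
    induction m with
    | zero => exact ⟨0, fun u x hu => by simp [hu x (by simp)]⟩
    | succ m ih =>
      obtain ⟨r, hr⟩ := ih
      refine ⟨r + 1, fun u x hu => ?_⟩
      rw [← monomial_mul_X, map_mul, aeval_X, Module.End.mul_apply]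
      refine hr _ _ fun z hz => ?_
      have hsingle : ∀ i j : Fin n, ((Pi.single i 1 : Fin n → ℤ) j).natAbs ≤ 1 := by
        intro i j
        by_cases hij : j = i
        · subst hij; simp
        · simp [hij]
      rw [layerOperator_apply, hu z fun i => (hz i).trans (Nat.le_succ r),
        Finset.sum_eq_zero fun i _ => ?_, mul_zero, sub_zero]
      rw [hu _ fun j => ?_, hu _ fun j => ?_, add_zero]
      all_goals
        have h1 := hz j
        have h2 := hsingle i j
        simp only [Pi.add_apply, Pi.sub_apply]
        omega

/-! ### Harmonic extension from two layers. -/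

/-- The harmonic function on `ℤ^n × ℤ` with prescribed values on the layers `0` (index `false`)
and `1` (index `true`). -/
noncomputable def harmonicExtension (n : ℕ) :
    ((Fin n → ℤ) × Bool → ℤ) →ₗ[ℤ] ((Fin n → ℤ) × ℤ → ℤ) where
  toFun h v := aeval (layerOperator n) (S ℤ (v.2 - 1)) (fun x => h (x, true)) v.1 -
    aeval (layerOperator n) (S ℤ (v.2 - 2)) (fun x => h (x, false)) v.1
  map_add' h h' := by
    ext v
    have e : ∀ P : ℤ[X], ∀ b, aeval (layerOperator n) P (fun x => (h + h') (x, b)) =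
        aeval (layerOperator n) P (fun x => h (x, b)) +
          aeval (layerOperator n) P (fun x => h' (x, b)) :=
      fun P _ => map_add (aeval (layerOperator n) P) _ _
    rw [e, e]
    simp only [Pi.add_apply]
    ring
  map_smul' c h := by
    ext v
    have e : ∀ P : ℤ[X], ∀ b, aeval (layerOperator n) P (fun x => (c • h) (x, b)) =
        c • aeval (layerOperator n) P (fun x => h (x, b)) :=
      fun P _ => map_smul (aeval (layerOperator n) P) _ _
    rw [e, e]
    simp only [Pi.smul_apply, smul_eq_mul, RingHom.id_apply]
    ring

namespace harmonicExtension

variable {n : ℕ}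

theorem apply (h : (Fin n → ℤ) × Bool → ℤ) (v : (Fin n → ℤ) × ℤ) : harmonicExtension n h v =
    aeval (layerOperator n) (S ℤ (v.2 - 1)) (fun x => h (x, true)) v.1 -
      aeval (layerOperator n) (S ℤ (v.2 - 2)) (fun x => h (x, false)) v.1 :=
  rfl

/-- This is the recursion `S (k+1) + S (k-1) = X * S k` evaluated at the layer operator. -/
theorem harmonic (h : (Fin n → ℤ) × Bool → ℤ) (x : Fin n → ℤ) (t : ℤ) :
    harmonicExtension n h (x, t + 1) + harmonicExtension n h (x, t - 1) +
      ∑ i, (harmonicExtension n h (x + Pi.single i 1, t) +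
        harmonicExtension n h (x - Pi.single i 1, t)) =
      2 * (n + 1) * harmonicExtension n h (x, t) := by
  have hS : ∀ (k : ℤ) (u : (Fin n → ℤ) → ℤ), aeval (layerOperator n) (S ℤ (k + 1)) u x +
      aeval (layerOperator n) (S ℤ (k - 1)) u x + ∑ i,
        (aeval (layerOperator n) (S ℤ k) u (x + Pi.single i 1) +
          aeval (layerOperator n) (S ℤ k) u (x - Pi.single i 1)) =
      2 * (n + 1) * aeval (layerOperator n) (S ℤ k) u x := by
    intro k u
    rw [S_add_one, map_sub, map_mul, aeval_X, LinearMap.sub_apply, Module.End.mul_apply,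
      Pi.sub_apply, layerOperator_apply]
    ring
  have h1 := hS (t - 1) fun x => h (x, true)
  have h2 := hS (t - 2) fun x => h (x, false)
  rw [Finset.sum_add_distrib] at h1 h2 ⊢
  simp only [apply, Finset.sum_sub_distrib]
  rw [show t + 1 - 1 = t - 1 + 1 by ring, show t + 1 - 2 = t - 2 + 1 by ring,
    show t - 1 - 2 = t - 2 - 1 by ring]
  linarith

/-- The vertex at which an initial datum sits. -/
def vertex (s : (Fin n → ℤ) × Bool) : (Fin n → ℤ) × ℤ := (s.1, if s.2 then 1 else 0)

theorem apply_vertex (h : (Fin n → ℤ) × Bool → ℤ) (s : (Fin n → ℤ) × Bool) :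
    harmonicExtension n h (vertex s) = h s := by
  obtain ⟨x, _ | _⟩ := s <;> simp [apply, vertex]

/-- The harmonic extension has finite range, uniformly in bounded time. -/
theorem exists_range (n M : ℕ) : ∃ r : ℕ, ∀ (h : (Fin n → ℤ) × Bool → ℤ) (v : (Fin n → ℤ) × ℤ),
    v.2.natAbs ≤ M → (∀ s, (∀ i, (s.1 i - v.1 i).natAbs ≤ r) → h s = 0) →
      harmonicExtension n h v = 0 := by
  choose r hr using exists_range_aeval_layerOperator n
  let b : ℤ → ℕ := fun t => max (r (S ℤ (t - 1))) (r (S ℤ (t - 2)))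
  refine ⟨(Finset.Icc (-M : ℤ) M).sup b, fun h v hv hh => ?_⟩
  have hb : b v.2 ≤ (Finset.Icc (-M : ℤ) M).sup b := Finset.le_sup (by
    rw [Finset.mem_Icc]
    omega)
  rw [apply,
    hr _ _ _ fun z hz => hh _ fun i => (hz i).trans ((le_max_left _ _).trans hb),
    hr _ _ _ fun z hz => hh _ fun i => (hz i).trans ((le_max_right _ _).trans hb), sub_zero]

/-! ### Separating vertices by hyperplane data. -/

/-- Initial data depending on a single coordinate, concentrated on one layer and one hyperplane. -/
def hyperplane (i : Fin n) (b : Bool) (y : ℤ) (s : (Fin n → ℤ) × Bool) : ℤ :=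
  if s.2 = b then (Pi.single y 1 : ℤ → ℤ) (s.1 i) else 0

theorem hyperplane_eq_zero {i : Fin n} {b : Bool} {y : ℤ} {s : (Fin n → ℤ) × Bool}
    (hs : s.2 = b → s.1 i ≠ y) : hyperplane i b y s = 0 := by
  unfold hyperplane
  split_ifs with h
  · exact Pi.single_eq_of_ne (hs h) _
  · rfl

theorem hyperplane_true (i : Fin n) (y : ℤ) (v : (Fin n → ℤ) × ℤ) :
    harmonicExtension n (hyperplane i true y) v = lineKernel v.2 y (v.1 i) := by
  have h0 : (fun _ => 0 : (Fin n → ℤ) → ℤ) = 0 := rfl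
  have := congrFun (aeval_layerOperator_comp_eval i (S ℤ (v.2 - 1)) (Pi.single y 1)) v.1
  simpa [apply, hyperplane, h0, lineKernel] using this

/-- The time shift matters: layer-0 data are blind on layer 1 and layer-1 data on layer 0, so the
two kinds together see every vertex. -/
theorem hyperplane_false (i : Fin n) (y : ℤ) (v : (Fin n → ℤ) × ℤ) :
    harmonicExtension n (hyperplane i false y) v = -lineKernel (v.2 - 1) y (v.1 i) := by
  have h0 : (fun _ => 0 : (Fin n → ℤ) → ℤ) = 0 := rfl
  have := congrFun (aeval_layerOperator_comp_eval i (S ℤ (v.2 - 2)) (Pi.single y 1)) v.1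
  rw [show v.2 - 2 = v.2 - 1 - 1 by ring] at this
  simpa [apply, hyperplane, h0, lineKernel, show v.2 - 2 = v.2 - 1 - 1 by ring] using this

/-- Vertices confused by all data on hyperplanes of layer `1` at distance more than `R`. -/
theorem rigidity_true {R : ℤ} {v w : (Fin n → ℤ) × ℤ} (i : Fin n)
    (h : ∀ y : ℤ, R < y.natAbs → harmonicExtension n (hyperplane i true y) v =
      harmonicExtension n (hyperplane i true y) w) :
    (v.2 = w.2 ∧ (v.2 = 0 ∨ v.1 i = w.1 i)) ∨
      ((v.2 ≠ 0 → ((v.1 i).natAbs + v.2.natAbs : ℤ) ≤ R + 2) ∧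
        (w.2 ≠ 0 → ((w.1 i).natAbs + w.2.natAbs : ℤ) ≤ R + 2)) :=
  lineKernel_rigidity fun y hy => by simpa only [hyperplane_true] using h y hy

/-- Vertices confused by all data on hyperplanes of layer `0` at distance more than `R`. -/
theorem rigidity_false {R : ℤ} {v w : (Fin n → ℤ) × ℤ} (i : Fin n)
    (h : ∀ y : ℤ, R < y.natAbs → harmonicExtension n (hyperplane i false y) v =
      harmonicExtension n (hyperplane i false y) w) :
    (v.2 - 1 = w.2 - 1 ∧ (v.2 - 1 = 0 ∨ v.1 i = w.1 i)) ∨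
      ((v.2 - 1 ≠ 0 → ((v.1 i).natAbs + (v.2 - 1).natAbs : ℤ) ≤ R + 2) ∧
        (w.2 - 1 ≠ 0 → ((w.1 i).natAbs + (w.2 - 1).natAbs : ℤ) ≤ R + 2)) :=
  lineKernel_rigidity fun y hy => by simpa only [hyperplane_false, neg_inj] using h y hy

/-- Vertices are separated by suitable initial data. -/
theorem separates [NeZero n] (v w : (Fin n → ℤ) × ℤ)
    (h : ∀ f, harmonicExtension n f v = harmonicExtension n f w) : v = w := by
  -- With `R = -3` every `y` is allowed and the bound `R + 2 < 0` is unattainable, so only equality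
  -- or blind layers remain.
  have ht := rigidity_true (R := -3) (v := v) (w := w)
  have hf := rigidity_false (R := -3) (v := v) (w := w)
  have key : ∀ i, v.2 = w.2 ∧ v.1 i = w.1 i := by
    intro i
    have h1 := ht i fun y _ => h _
    have h2 := hf i fun y _ => h _
    omega
  exact Prod.ext (funext fun i => (key i).2) (key 0).1

theorem exists_coordinate_bound (T : Finset ((Fin n → ℤ) × Bool)) :
    ∃ R : ℕ, ∀ s ∈ T, ∀ i, (s.1 i).natAbs ≤ R :=
  ⟨T.sup fun s => Finset.univ.sup fun i => (s.1 i).natAbs, fun s hs i =>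
    (Finset.le_sup (f := fun i => (s.1 i).natAbs) (Finset.mem_univ i)).trans
      (Finset.le_sup (f := fun s : (Fin n → ℤ) × Bool =>
        Finset.univ.sup fun i => (s.1 i).natAbs) hs)⟩

/-- Knowing the data on a finite set, only finitely many vertices can be confused. -/
theorem finite_confused [NeZero n] (T : Finset ((Fin n → ℤ) × Bool)) :
    ∃ B : Set ((Fin n → ℤ) × ℤ), B.Finite ∧ ∀ v w, v ≠ w →
      (∀ h : (Fin n → ℤ) × Bool → ℤ, (∀ s ∈ T, h s = 0) →
        harmonicExtension n h v = harmonicExtension n h w) → v ∈ B := by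
  obtain ⟨R, hR⟩ := exists_coordinate_bound T
  obtain ⟨r, hr⟩ := exists_range n (R + 3)
  let C : ℤ := R + r + 3
  refine ⟨Set.Icc (fun _ => -C) (fun _ => C) ×ˢ Set.Icc (-C) C,
    (Set.finite_Icc _ _).prod (Set.finite_Icc _ _), fun v w hvw h => ?_⟩
  have hplane : ∀ i b (y : ℤ), (R : ℤ) < y.natAbs → harmonicExtension n (hyperplane i b y) v =
      harmonicExtension n (hyperplane i b y) w := by
    intro i b y hy
    refine h _ fun s hs => hyperplane_eq_zero fun _ hsy => ?_
    have := hR s hs i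
    omega
  have hbound : v.2.natAbs ≤ R + 3 ∧ ∀ i, (v.1 i).natAbs ≤ R + r + 3 := by
    by_cases ht : v.2 = w.2
    · obtain ⟨j, hj⟩ : ∃ j, v.1 j ≠ w.1 j := by
        by_contra! hcon
        exact hvw (Prod.ext (funext hcon) ht)
      have h1 := rigidity_true j (hplane j true)
      have h2 := rigidity_false j (hplane j false)
      have hv : v.2.natAbs ≤ R + 3 := by omega
      refine ⟨hv, fun i => ?_⟩
      have h3 := rigidity_true i (hplane i true)
      have h4 := rigidity_false i (hplane i false)
      by_cases hi : v.1 i = w.1 i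
      -- If a shared coordinate is this large, neither vertex can feel `T`; being confused by data
      -- vanishing on `T`, they would be confused by all data.
      · by_contra! hfar
        refine hvw (separates v w fun f => ?_)
        classical
        have hcut : ∀ u : (Fin n → ℤ) × ℤ, u.2.natAbs ≤ R + 3 → u.1 i = v.1 i →
            harmonicExtension n f u =
              harmonicExtension n (fun s => if s ∈ T then 0 else f s) u := by
          intro u hu hui
          rw [← sub_eq_zero, ← Pi.sub_apply, ← map_sub]
          refine hr _ _ hu fun s hs => ?_
          have hsT : s ∉ T := fun hsT => by
            have := hR s hsT i
            have := hs i
            omega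
          simp [hsT]
        rw [hcut v hv rfl, hcut w (ht ▸ hv) hi.symm]
        exact h _ fun s hs => if_pos hs
      · omega
    · have hi : ∀ i, v.2.natAbs ≤ R + 3 ∧ (v.1 i).natAbs ≤ R + r + 3 := by
        intro i
        have h1 := rigidity_true i (hplane i true)
        have h2 := rigidity_false i (hplane i false)
        omega
      exact ⟨(hi 0).1, fun i => (hi i).2⟩
  obtain ⟨h1, h2⟩ := hbound
  refine ⟨⟨fun i => ?_, fun i => ?_⟩, ?_, ?_⟩
  · have := h2 i
    change -(R + r + 3 : ℤ) ≤ v.1 i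
    omega
  · have := h2 i
    change v.1 i ≤ (R + r + 3 : ℤ)
    omega
  · change -(R + r + 3 : ℤ) ≤ v.2
    omega
  · change v.2 ≤ (R + r + 3 : ℤ)
    omega

/-- A far away datum on layer `0` only influences differences involving its own vertex. -/
theorem exists_isolated [NeZero n] (T : Finset ((Fin n → ℤ) × Bool)) :
    ∃ s ∉ T, ∀ v w, (∀ h : (Fin n → ℤ) × Bool → ℤ, h s = 0 → (∀ u ∈ T, h u = 0) →
        harmonicExtension n h v = harmonicExtension n h w) →
      harmonicExtension n (Pi.single s 1) v ≠ harmonicExtension n (Pi.single s 1) w →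
      (v = vertex s ∧ harmonicExtension n (Pi.single s 1) w = 0) ∨
        (w = vertex s ∧ harmonicExtension n (Pi.single s 1) v = 0) := by
  obtain ⟨R, hR⟩ := exists_coordinate_bound T
  obtain ⟨r, hr⟩ := exists_range n (R + 2)
  -- Every coordinate exceeds `R + 2` by more than `r`, so vertices within the rigidity bound do not
  -- feel `s`. On layer 0, `s` is avoided by all layer-1 hyperplanes and felt in its own layer only
  -- at its own vertex.
  let s : (Fin n → ℤ) × Bool := (fun _ => R + r + 3, false)
  have hsi : ∀ i, s.1 i = R + r + 3 := fun _ => rfl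
  refine ⟨s, fun hs => ?_, fun v w h hne => ?_⟩
  · have := hR s hs 0
    rw [hsi] at this
    omega
  have hplane : ∀ i (y : ℤ), (R : ℤ) < y.natAbs →
      harmonicExtension n (hyperplane i true y) v =
        harmonicExtension n (hyperplane i true y) w := by
    intro i y hy
    refine h _ (hyperplane_eq_zero fun hs => by simp [s] at hs) fun u hu =>
      hyperplane_eq_zero fun _ huy => ?_
    have := hR u hu i
    omega
  have hrigid := fun i => rigidity_true i (hplane i)
  have hzero : ∀ (u : (Fin n → ℤ) × ℤ) i, ((u.1 i).natAbs + u.2.natAbs : ℤ) ≤ R + 2 →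
      harmonicExtension n (Pi.single s 1) u = 0 := by
    intro u i hu
    refine hr _ _ (by omega) fun z hz => Pi.single_eq_of_ne (fun hzs => ?_) _
    have := hz i
    rw [hzs, hsi] at this
    omega
  have hlayer : ∀ u : (Fin n → ℤ) × ℤ, u.2 = 0 →
      harmonicExtension n (Pi.single s 1) u = 0 ∨ u = vertex s := by
    intro u hu
    have huv : u = vertex (u.1, false) := Prod.ext rfl hu
    rw [huv, apply_vertex]
    by_cases hus : (u.1, false) = s
    · exact Or.inr (congrArg vertex hus)
    · exact Or.inl (Pi.single_eq_of_ne hus _)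
  by_cases hv : v.2 = 0
  · by_cases hw : w.2 = 0
    · rcases hlayer v hv with h1 | h1 <;> rcases hlayer w hw with h2 | h2
      · exact (hne (h1.trans h2.symm)).elim
      · exact Or.inr ⟨h2, h1⟩
      · exact Or.inl ⟨h1, h2⟩
      · exact (hne (by rw [h1, h2])).elim
    · have hw0 := hzero w 0 (by have := hrigid 0; omega)
      rw [hw0] at hne
      exact Or.inl ⟨(hlayer v hv).resolve_left hne, hw0⟩
  · by_cases hw : w.2 = 0
    · have hv0 := hzero v 0 (by have := hrigid 0; omega)
      rw [hv0] at hne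
      exact Or.inr ⟨(hlayer w hw).resolve_left hne.symm, hv0⟩
    · exfalso
      obtain ⟨i, hi⟩ : ∃ i, ¬ (v.2 = w.2 ∧ v.1 i = w.1 i) := by
        by_contra! hcon
        exact hne (by rw [Prod.ext (funext fun i => (hcon i).2) (hcon 0).1])
      have := hrigid i
      exact hne ((hzero v i (by omega)).trans (hzero w i (by omega)).symm)

/-- Every value of the harmonic extension depends on finitely many data. -/
theorem exists_finset_dependence (v : (Fin n → ℤ) × ℤ) : ∃ F : Finset ((Fin n → ℤ) × Bool),
    ∀ h : (Fin n → ℤ) × Bool → ℤ, (∀ s ∈ F, h s = 0) → harmonicExtension n h v = 0 := by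
  obtain ⟨r, hr⟩ := exists_range n v.2.natAbs
  refine ⟨Finset.Icc (fun i => v.1 i - r) (fun i => v.1 i + r) ×ˢ Finset.univ,
    fun h hh => hr h v le_rfl fun s hs => hh s ?_⟩
  rw [Finset.mem_product, Finset.mem_Icc]
  refine ⟨⟨fun i => ?_, fun i => ?_⟩, Finset.mem_univ _⟩ <;>
  · have := hs i
    dsimp only
    omega

theorem exists_bijective (n : ℕ) [NeZero n] :
    ∃ h, Function.Bijective (harmonicExtension n h) :=
  SeparatingCondition.exists_bijective _ vertex apply_vertex exists_finset_dependence separates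
    finite_confused exists_isolated

end harmonicExtension

/-! ### Lattice neighbours and conclusion. -/

theorem latticeGraph_adj_iff {d : ℕ} (x y : Fin d → ℤ) : (latticeGraph d).Adj x y ↔
    ∃ i, y = x + Pi.single i 1 ∨ y = x - Pi.single i 1 := by
  change ∑ i, |x i - y i| = 1 ↔ _
  constructor
  · intro h
    obtain ⟨i, -, hi⟩ : ∃ i ∈ Finset.univ, |x i - y i| ≠ 0 :=
      Finset.exists_ne_zero_of_sum_ne_zero (by rw [h]; exact one_ne_zero)
    have hpos : 0 < |x i - y i| := lt_of_le_of_ne (abs_nonneg _) hi.symm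
    rw [← Finset.add_sum_erase _ _ (Finset.mem_univ i)] at h
    have hnonneg : 0 ≤ ∑ j ∈ Finset.univ.erase i, |x j - y j| :=
      Finset.sum_nonneg fun _ _ => abs_nonneg _
    have hrest : ∀ j, j ≠ i → y j = x j := by
      intro j hj
      have h0 : ∑ j ∈ Finset.univ.erase i, |x j - y j| = 0 := by omega
      have := (Finset.sum_eq_zero_iff_of_nonneg fun _ _ => abs_nonneg _).1 h0 j
        (Finset.mem_erase.2 ⟨hj, Finset.mem_univ j⟩)
      exact (sub_eq_zero.1 (abs_eq_zero.1 this)).symm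
    have hone : |x i - y i| = 1 := by omega
    refine ⟨i, ?_⟩
    rcases (abs_eq zero_le_one).1 hone with h1 | h1
    · right
      ext j
      by_cases hj : j = i
      · subst hj
        simp only [Pi.sub_apply, Pi.single_eq_same]
        omega
      · simp [hj, hrest j hj]
    · left
      ext j
      by_cases hj : j = i
      · subst hj
        simp only [Pi.add_apply, Pi.single_eq_same]
        omega
      · simp [hj, hrest j hj]
  · rintro ⟨i, rfl | rfl⟩ <;>
    · rw [Finset.sum_eq_single i] <;> simp +contextual

/-- Harmonicity on the lattice, with the neighbours of `x` written as the points `x ± eᵢ`. -/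
theorem isHarmonicFun_latticeGraph {d : ℕ} (hd : 1 ≤ d) {φ : (Fin d → ℤ) → ℤ}
    (hφ : ∀ x, ∑ i, (φ (x + Pi.single i 1) + φ (x - Pi.single i 1)) = 2 * d * φ x) :
    IsHarmonicFun (latticeGraph d) φ := by
  classical
  intro x
  let e : Fin d × Bool → Fin d → ℤ :=
    fun z => x + if z.2 then Pi.single z.1 1 else -Pi.single z.1 1
  have he : Function.Injective e := by
    rintro ⟨i, b⟩ ⟨j, c⟩ h
    have h' := add_left_cancel h
    have hi := congrFun h' i
    by_cases hij : i = j
    · subst hij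
      cases b <;> cases c <;> first | rfl | norm_num at hi
    · cases b <;> cases c <;> simp [hij] at hi
  have hN : (latticeGraph d).neighborFinset x = Finset.univ.image e := by
    ext y
    rw [SimpleGraph.mem_neighborFinset, latticeGraph_adj_iff]
    simp only [Finset.mem_image, Finset.mem_univ, true_and, Prod.exists, Bool.exists_bool, e]
    refine exists_congr fun i => ?_
    simp [sub_eq_add_neg, eq_comm (a := y), or_comm]
  have hdeg : (latticeGraph d).degree x = d * 2 := by
    rw [← SimpleGraph.card_neighborFinset_eq_degree, hN, Finset.card_image_of_injective _ he]
    simp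
  have hsum : ∑ y ∈ (latticeGraph d).neighborFinset x, (φ y : ℚ) = 2 * d * φ x := by
    rw [hN, Finset.sum_image he.injOn, Fintype.sum_prod_type]
    have := hφ x
    simp only [Fintype.sum_bool, e]
    exact_mod_cast this
  rw [hsum, hdeg]
  have : (d : ℚ) ≠ 0 := by positivity
  push_cast
  field_simp

theorem mainTheorem3 (d : ℕ) (hd : 1 ≤ d) :
    ∃ φ : (Fin d → ℤ) → ℤ, IsHarmonicLabeling (latticeGraph d) φ := by
  obtain ⟨n, rfl⟩ : ∃ n, d = n + 1 := ⟨d - 1, by omega⟩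
  -- The separation argument needs at least one coordinate within the layers.
  rcases Nat.eq_zero_or_pos n with rfl | hn
  · refine ⟨fun x => x 0, isHarmonicFun_latticeGraph le_rfl fun x => ?_, fun x y h => ?_,
      fun k => ⟨fun _ => k, rfl⟩⟩
    · simp; ring
    · ext i
      rw [Fin.fin_one_eq_zero i]
      exact h
  · have : NeZero n := ⟨hn.ne'⟩
    obtain ⟨h, hh⟩ := harmonicExtension.exists_bijective n
    -- Coordinate 0 plays the role of time.
    refine ⟨fun z => harmonicExtension n h (Fin.tail z, z 0),
      isHarmonicFun_latticeGraph hd fun z => ?_, ?_⟩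
    · rw [Fin.sum_univ_succ]
      have key := harmonicExtension.harmonic h (Fin.tail z) (z 0)
      have e0 : ∀ c : ℤ, Fin.tail (z + Pi.single 0 c) = Fin.tail z := by
        intro c
        ext i
        simp [Fin.tail]
      have e0' : Fin.tail (z - Pi.single 0 1) = Fin.tail z := by
        ext i
        simp [Fin.tail]
      have e1 : ∀ i, Fin.tail (z + Pi.single (Fin.succ i) 1) = Fin.tail z + Pi.single i 1 := by
        intro i
        ext j
        simp [Fin.tail, Pi.single_apply]
      have e1' : ∀ i, Fin.tail (z - Pi.single (Fin.succ i) 1) = Fin.tail z - Pi.single i 1 := by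
        intro i
        ext j
        simp [Fin.tail, Pi.single_apply]
      simp only [e0, e0', e1, e1', Pi.add_apply, Pi.sub_apply, Pi.single_eq_same,
        Pi.single_eq_of_ne (Fin.succ_ne_zero _).symm, add_zero, sub_zero]
      push_cast
      exact key
    · have hb : Function.Bijective fun z : Fin (n + 1) → ℤ => (Fin.tail z, z 0) := by
        refine ⟨fun z z' h => ?_, fun v => ⟨Fin.cons v.2 v.1, by simp⟩⟩
        rw [Prod.mk.injEq] at h
        rw [← Fin.cons_self_tail z, ← Fin.cons_self_tail z', h.1, h.2]
      exact hh.comp hb
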